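/- Consider the linear system under attack, for $0\le k\le T$, $$x_{k+1}=Ax_k+Bu_k+B^au^a_k+w_k,\qquad y_k=Cx_k+D^ad^a_k+v_k,$$ with $x_k\in\mathbb R^n$, $u_k\in\mathbb R^p$, $y_k\in\mathbb R^m$, $u^a_k\in\mathbb R^{p'}$, $d^a_k\in\mathbb R^{m'}$, where $x_0\sim\mathcal N(\hat x_{0|-1},P_{0|-1})$, $w_k\sim\mathcal N(0,Q)$, $v_k\sim\mathcal N(0,R)$ are mutually independent ($P_{0|-1},Q,R$ positive semidefinite), $B^a$ is a fixed matrix, and $D^a$ is the $m\times m'$ matrix with entries $D^a_{i,j}=1$ if $i=\gamma_j$ and $0$ otherwise, for distinct sensors $\gamma_1,\dots,\gamma_{m'}\in\{1,\dots,m\}$. The defender uses a control strategy $u_k=\mathcal U_k(y_{0:k},u_{0:k-1})$ with arbitrary deterministic measurable functions $\mathcal U_k$. The attacker uses a false-data-injection policy, i.e. deterministic measurable functions that do not read the defender's outputs or inputs: $$d^a_k=\mathcal D^a_k(u^a_{0:k-1},d^a_{0:k-1}),\qquad u^a_k=\mathcal U^a_k(u^a_{0:k-1},d^a_{0:k})$$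 (any prior knowledge of the attacker is a fixed parameter of these functions). Define $P_{k|k-1}$ and $K_k$ by the Kalman recursion started at $P_{0|-1}$, $$K_k=P_{k|k-1}C^T(CP_{k|k-1}C^T+R)^{-1},\qquad P_{k+1|k}=AP_{k|k-1}A^T+Q-AK_kCP_{k|k-1}A^T,$$ the Kalman prediction, started at $\hat x_{0|-1}$, by $$\hat x_{k|k}=(I-K_kC)\hat x_{k|k-1}+K_ky_k,\qquad \hat x_{k+1|k}=A\hat x_{k|k}+Bu_k,$$ and the normalized residue by $z_k=(CP_{k|k-1}C^T+R)^{-1/2}(y_k-C\hat x_{k|k-1})$; assume that $CP_{k|k-1}C^T+R$ is invertible for $0\le k\le T$. The information flow of the attack is $$IF_T=\frac1{T+1}\,D_{KL}\big(\mathbb D_{y_{0:T}}\,\big\|\,\mathbb D^{0}_{y_{0:T}}\big)\in[0,\infty],$$ where $\mathbb D_{y_{0:T}}$ is the law of $y_{0:T}=(y_0,\dots,y_T)$ under the attack and $\mathbb D^{0}_{y_{0:T}}$ is its law under the same defender strategy when all $u^a_k$ and $d^a_k$ are $0$. Let $\Delta e_{0|-1}=0$ and $$\Delta e_{k+1|k}=(A-AK_kC)\Delta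 e_{k|k-1}+B^au^a_k-AK_kD^ad^a_k,\qquad \Delta z_k=(CP_{k|k-1}C^T+R)^{-1/2}\big(C\Delta e_{k|k-1}+D^ad^a_k\big).$$ Then $\Delta z_k$ is the (deterministic) bias of the normalized residue: for each realization of $x_0,(w_k),(v_k)$ and each $0\le k\le T$, the residue under attack equals the residue of the system without attack, driven by the same realization, plus $\Delta z_k$. Moreover, $$IF_T=\frac{1}{2(T+1)}\sum_{k=0}^{T}\|\Delta z_k\|^2=\frac{1}{2(T+1)}\,\Delta z_{0:T}^T\,\Delta z_{0:T}.$$ -/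

import Mathlib

open MeasureTheory ProbabilityTheory Matrix
open scoped ENNReal MatrixOrder

namespace CPS

/-- The law `𝒩(μ, Σ)` on `ℝ^ι` (written as `ι → ℝ`). -/
noncomputable def gaussianLaw {ι : Type} [Fintype ι] [DecidableEq ι]
    (μ : ι → ℝ) (Sig : Matrix ι ι ℝ) : Measure (ι → ℝ) :=
  (multivariateGaussian (WithLp.toLp 2 μ) Sig).map WithLp.ofLp

/-- The plant model `ℳ = {A, B, C, Q, R, x̂_{0|-1}, P_{0|-1}}` with `n` states, `p` control inputs
and `m` sensors. `Q`, `R` and `P_{0|-1}` are covariance matrices. -/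
structure Model (n p m : ℕ) where
  A : Matrix (Fin n) (Fin n) ℝ
  B : Matrix (Fin n) (Fin p) ℝ
  C : Matrix (Fin m) (Fin n) ℝ
  Q : Matrix (Fin n) (Fin n) ℝ
  R : Matrix (Fin m) (Fin m) ℝ
  xhat0 : Fin n → ℝ
  P0 : Matrix (Fin n) (Fin n) ℝ
  Q_posSemidef : Q.PosSemidef
  R_posSemidef : R.PosSemidef
  P0_posSemidef : P0.PosSemidef

/-- The channels open to the attacker: the input matrix `Bᵃ` and the `m'` distinct sensors
`γ_1, …, γ_{m'}` that can be modified. -/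
structure Channels (n m p' m' : ℕ) where
  Ba : Matrix (Fin n) (Fin p') ℝ
  sensor : Fin m' ↪ Fin m

/-- `Dᵃ`: the entry `(i, j)` is `1` if `i = γ_j` and `0` otherwise. -/
def Channels.Da {n m p' m' : ℕ} (S : Channels n m p' m') : Matrix (Fin m) (Fin m') ℝ :=
  Matrix.of fun i j => if i = S.sensor j then 1 else 0

/-- An admissible defender control strategy: `u_k = 𝒰_k(y_{0:k}, u_{0:k-1})`, with `𝒰_k` measurable
and deterministic. The model is fixed, so the dependence of `𝒰_k` on it is not displayed; over
the horizon `T` only `𝒰_0, …, 𝒰_{T-1}` matter. -/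
structure DefenderStrategy (p m : ℕ) where
  toFun : (k : ℕ) → (Fin (k + 1) → Fin m → ℝ) → (Fin k → Fin p → ℝ) → Fin p → ℝ
  measurable' : ∀ k, Measurable fun h : (Fin (k + 1) → Fin m → ℝ) × (Fin k → Fin p → ℝ) =>
    toFun k h.1 h.2

/-- An admissible false-data-injection policy:
`d_kᵃ = 𝒟_kᵃ(uᵃ_{0:k-1}, dᵃ_{0:k-1})` and `u_kᵃ = 𝒰_kᵃ(uᵃ_{0:k-1}, dᵃ_{0:k})`, with measurable
deterministic maps that do not read the defender's outputs. The attacker's prior knowledge of the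
plant, the controller and the detector is a fixed parameter of these maps. -/
structure FDIPolicy (p' m' : ℕ) where
  d : (k : ℕ) → (Fin k → Fin p' → ℝ) → (Fin k → Fin m' → ℝ) → Fin m' → ℝ
  u : (k : ℕ) → (Fin k → Fin p' → ℝ) → (Fin (k + 1) → Fin m' → ℝ) → Fin p' → ℝ
  measurable_d : ∀ k, Measurable fun h : (Fin k → Fin p' → ℝ) × (Fin k → Fin m' → ℝ) =>
    d k h.1 h.2
  measurable_u : ∀ k, Measurable fun h : (Fin k → Fin p' → ℝ) × (Fin (k + 1) → Fin m' → ℝ) =>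
    u k h.1 h.2

namespace FDIPolicy

variable {p' m' : ℕ}

/-- Normal operation: all attack inputs vanish. -/
def none : FDIPolicy p' m' where
  d := fun _ _ _ => 0
  u := fun _ _ _ => 0
  measurable_d := fun _ => measurable_const
  measurable_u := fun _ => measurable_const

/-- The pair `(u_kᵃ, d_kᵃ)` of attack inputs that the policy generates at time `k`. -/
def inputs (att : FDIPolicy p' m') (k : ℕ) : (Fin p' → ℝ) × (Fin m' → ℝ) :=
  let uPast : Fin k → Fin p' → ℝ := fun i => (inputs att i).1
  let dPast : Fin k → Fin m' → ℝ := fun i => (inputs att i).2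
  let dNow : Fin m' → ℝ := att.d k uPast dPast
  (att.u k uPast (Fin.snoc (α := fun _ => Fin m' → ℝ) dPast dNow), dNow)
termination_by k
decreasing_by all_goals exact i.2

/-- The attack input `u_kᵃ`. -/
def uInput (att : FDIPolicy p' m') (k : ℕ) : Fin p' → ℝ := (att.inputs k).1

/-- The attack input `d_kᵃ`. -/
def dInput (att : FDIPolicy p' m') (k : ℕ) : Fin m' → ℝ := (att.inputs k).2

end FDIPolicy

/-- A realization of the primitive randomness: `x_0`, the process noise `(w_k)` and the measurement
noise `(v_k)`. -/
abbrev Noise (n m : ℕ) : Type := (Fin n → ℝ) × (ℕ → Fin n → ℝ) × (ℕ → Fin m → ℝ)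

/-- State, measurement and defender input at one time step. -/
structure Sample (n p m : ℕ) where
  x : Fin n → ℝ
  y : Fin m → ℝ
  u : Fin p → ℝ

namespace Model

variable {n p m p' m' : ℕ}

/-- The law of `(x_0, w, v)`: these are independent, `x_0 ∼ 𝒩(x̂_{0|-1}, P_{0|-1})`, the `w_k` are
i.i.d. `𝒩(0, Q)` and the `v_k` are i.i.d. `𝒩(0, R)`. -/
noncomputable def noiseLaw (M : Model n p m) : Measure (Noise n m) :=
  (gaussianLaw M.xhat0 M.P0).prod
    ((Measure.infinitePi fun _ : ℕ => gaussianLaw 0 M.Q).prod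
      (Measure.infinitePi fun _ : ℕ => gaussianLaw 0 M.R))

/-- The closed loop under attack, for one realization `ω = (x_0, w, v)`:
`x_{k+1} = A x_k + B u_k + Bᵃ u_kᵃ + w_k`, `y_k = C x_k + Dᵃ d_kᵃ + v_k`,
`u_k = 𝒰_k(y_{0:k}, u_{0:k-1})`. -/
noncomputable def sample (M : Model n p m) (S : Channels n m p' m') (ctrl : DefenderStrategy p m)
    (att : FDIPolicy p' m') (ω : Noise n m) (k : ℕ) : Sample n p m :=
  let past : Fin k → Sample n p m := fun i => sample M S ctrl att ω i
  let xNow : Fin n → ℝ :=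
    match k, past with
    | 0, _ => ω.1
    | j + 1, past =>
      M.A *ᵥ (past (Fin.last j)).x + M.B *ᵥ (past (Fin.last j)).u
        + S.Ba *ᵥ att.uInput j + ω.2.1 j
  let yNow : Fin m → ℝ := M.C *ᵥ xNow + S.Da *ᵥ att.dInput k + ω.2.2 k
  { x := xNow
    y := yNow
    u := ctrl.toFun k (Fin.snoc (α := fun _ => Fin m → ℝ) (fun i => (past i).y) yNow)
      (fun i => (past i).u) }
termination_by k
decreasing_by exact i.2

/-- The distribution of the outputs `y_{0:T}`. -/
noncomputable def outputLaw (M : Model n p m) (S : Channels n m p' m')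
    (ctrl : DefenderStrategy p m) (att : FDIPolicy p' m') (T : ℕ) :
    Measure (Fin (T + 1) → Fin m → ℝ) :=
  M.noiseLaw.map fun ω (k : Fin (T + 1)) => (M.sample S ctrl att ω k).y

/-- The information flow `IF_T` from the attacker's inputs to the outputs `y_{0:T}`: `1/(T+1)` times
the Kullback-Leibler divergence of the law of `y_{0:T}` under attack from its law in normal
operation under the same defender strategy. -/
noncomputable def informationFlow (M : Model n p m) (S : Channels n m p' m')
    (ctrl : DefenderStrategy p m) (att : FDIPolicy p' m') (T : ℕ) : ℝ≥0∞ :=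
  InformationTheory.klDiv (M.outputLaw S ctrl att T) (M.outputLaw S ctrl FDIPolicy.none T)
    / ((T : ℝ≥0∞) + 1)

/-- The innovation covariance `C P Cᵀ + R` for the prediction covariance `P`. -/
def innovOf (M : Model n p m) (P : Matrix (Fin n) (Fin n) ℝ) : Matrix (Fin m) (Fin m) ℝ :=
  M.C * P * M.Cᵀ + M.R

/-- The Kalman gain `P Cᵀ (C P Cᵀ + R)⁻¹` for the prediction covariance `P`. -/
noncomputable def gainOf (M : Model n p m) (P : Matrix (Fin n) (Fin n) ℝ) :
    Matrix (Fin n) (Fin m) ℝ :=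
  P * M.Cᵀ * (M.innovOf P)⁻¹

/-- The Kalman prediction covariance `P_{k|k-1}`. -/
noncomputable def predCov (M : Model n p m) : ℕ → Matrix (Fin n) (Fin n) ℝ
  | 0 => M.P0
  | k + 1 => M.A * M.predCov k * M.Aᵀ + M.Q
      - M.A * M.gainOf (M.predCov k) * M.C * M.predCov k * M.Aᵀ

/-- The innovation covariance `C P_{k|k-1} Cᵀ + R`. -/
noncomputable def innovCov (M : Model n p m) (k : ℕ) : Matrix (Fin m) (Fin m) ℝ :=
  M.innovOf (M.predCov k)

/-- The Kalman gain `K_k`. -/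
noncomputable def gain (M : Model n p m) (k : ℕ) : Matrix (Fin n) (Fin m) ℝ :=
  M.gainOf (M.predCov k)

/-- The normalizing factor `(C P_{k|k-1} Cᵀ + R)^{-1/2}`. -/
noncomputable def innovInvSqrt (M : Model n p m) (k : ℕ) : Matrix (Fin m) (Fin m) ℝ :=
  (CFC.sqrt (M.innovCov k))⁻¹

/-- The Kalman prediction `x̂_{k|k-1}` from the outputs `y` and the defender inputs `u`:
`x̂_{k+1|k} = A x̂_{k|k} + B u_k` with `x̂_{k|k} = (I - K_k C) x̂_{k|k-1} + K_k y_k`. -/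
noncomputable def predict (M : Model n p m) (y : ℕ → Fin m → ℝ) (u : ℕ → Fin p → ℝ) :
    ℕ → Fin n → ℝ
  | 0 => M.xhat0
  | k + 1 =>
      M.A *ᵥ ((1 - M.gain k * M.C) *ᵥ M.predict y u k + M.gain k *ᵥ y k) + M.B *ᵥ u k

/-- The normalized residue `z_k = (C P_{k|k-1} Cᵀ + R)^{-1/2} (y_k - C x̂_{k|k-1})` of the closed
loop, for one realization of the noise. -/
noncomputable def residue (M : Model n p m) (S : Channels n m p' m') (ctrl : DefenderStrategy p m)
    (att : FDIPolicy p' m') (ω : Noise n m) (k : ℕ) : Fin m → ℝ :=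
  M.innovInvSqrt k *ᵥ
    ((M.sample S ctrl att ω k).y
      - M.C *ᵥ M.predict (fun j => (M.sample S ctrl att ω j).y)
          (fun j => (M.sample S ctrl att ω j).u) k)

/-- The error bias `Δe_{k|k-1}`: `Δe_{0|-1} = 0` and
`Δe_{k+1|k} = (A - A K_k C) Δe_{k|k-1} + Bᵃ u_kᵃ - A K_k Dᵃ d_kᵃ`. -/
noncomputable def errorBias (M : Model n p m) (S : Channels n m p' m') (att : FDIPolicy p' m') :
    ℕ → Fin n → ℝ
  | 0 => 0
  | k + 1 => (M.A - M.A * M.gain k * M.C) *ᵥ M.errorBias S att k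
      + S.Ba *ᵥ att.uInput k - (M.A * M.gain k * S.Da) *ᵥ att.dInput k

/-- The residue bias
`Δz_k = (C P_{k|k-1} Cᵀ + R)^{-1/2} (C Δe_{k|k-1} + Dᵃ d_kᵃ)`. -/
noncomputable def residueBias (M : Model n p m) (S : Channels n m p' m') (att : FDIPolicy p' m')
    (k : ℕ) : Fin m → ℝ :=
  M.innovInvSqrt k *ᵥ (M.C *ᵥ M.errorBias S att k + S.Da *ᵥ att.dInput k)

end Model

end CPS

/-! The policy never reads the outputs, so the attack inputs form a fixed sequence. Plant and Kalman
predictor receive the same `B u_k`; the prediction error therefore obeys a linear recursion free of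
the control strategy, and error and residue split into a noise part plus a deterministic bias
(`sample_x_sub_predict`, `residue_eq_noiseResidue_add`).

The noise part of the residues is white: their joint characteristic function is that of a standard
Gaussian vector (`map_noiseResidue`), because the covariance recursion preserves variances of linear
forms (`quadForm_step`). Under attack the residues are thus unit Gaussians with mean `Δz`, at
divergence `‖Δz‖² / 2` from the centred ones (`klDiv_pi_gaussianReal`).

Residues and outputs carry the same information. For a given strategy, one map `outputOfResidue`,
the same for every attack, rebuilds `y_{0:T}` from `z_{0:T}`; it is measurable and injective, so it
preserves the divergence. -/

namespace CPS

/-! ### Divergence: invariance and unit Gaussians -/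

/-- The Kullback-Leibler divergence is invariant under measurable embeddings. -/
lemma klDiv_map_of_measurableEmbedding {α β : Type*} [MeasurableSpace α] [MeasurableSpace β]
    [Nonempty α] {f : α → β} (hf : MeasurableEmbedding f) (μ ν : Measure α)
    [IsFiniteMeasure μ] [IsFiniteMeasure ν] :
    InformationTheory.klDiv (μ.map f) (ν.map f) = InformationTheory.klDiv μ ν := by
  refine le_antisymm (InformationTheory.klDiv_map_le _ _ hf.measurable) ?_
  -- The reverse inequality is data processing along a measurable left inverse of `f`.
  have key : ∀ ρ : Measure α, (ρ.map f).map hf.invFun = ρ := fun ρ => by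
    rw [Measure.map_map hf.measurable_invFun hf.measurable, hf.leftInverse_invFun.comp_eq_id,
      Measure.map_id]
  calc InformationTheory.klDiv μ ν
      = InformationTheory.klDiv ((μ.map f).map hf.invFun) ((ν.map f).map hf.invFun) := by
        rw [key, key]
    _ ≤ _ := InformationTheory.klDiv_map_le _ _ hf.measurable_invFun

/-- Completing the square: `-(x - a)² / 2 = -x² / 2 + (a x - a² / 2)`. The exponent is the
log-likelihood ratio used for the divergence. -/
lemma gaussianReal_eq_withDensity_exp (a : ℝ) :
    gaussianReal a 1
      = (gaussianReal 0 1).withDensity fun x => ENNReal.ofReal (Real.exp (a * x - a ^ 2 / 2)) := by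
  rw [gaussianReal_of_var_ne_zero _ one_ne_zero, gaussianReal_of_var_ne_zero _ one_ne_zero,
    ← withDensity_mul _ (measurable_gaussianPDF _ _) (by fun_prop)]
  congr 1
  ext x
  simp only [gaussianPDF, gaussianPDFReal, Pi.mul_apply]
  rw [← ENNReal.ofReal_mul (by positivity), mul_assoc _ (Real.exp _), ← Real.exp_add]
  congr 3
  simp
  ring

/-- A product of measures with densities has the product density. -/
lemma pi_withDensity_eq {ι : Type*} [Fintype ι] {X : ι → Type*} [∀ i, MeasurableSpace (X i)]
    (μ : (i : ι) → Measure (X i)) [∀ i, IsProbabilityMeasure (μ i)]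
    {f : (i : ι) → X i → ℝ≥0∞} (hf : ∀ i, Measurable (f i))
    [∀ i, SigmaFinite ((μ i).withDensity (f i))] :
    Measure.pi (fun i => (μ i).withDensity (f i))
      = (Measure.pi μ).withDensity fun x => ∏ i, f i (x i) := by
  refine (Measure.pi_eq fun s hs => ?_)
  rw [withDensity_apply _ (MeasurableSet.univ_pi hs),
    ← lintegral_indicator (MeasurableSet.univ_pi hs)]
  -- The indicator of a box is a product of indicators, so independence of the coordinates factors
  -- the integral.
  have h1 : (Set.univ.pi s).indicator (fun x => ∏ i, f i (x i))
      = fun x => ∏ i, (s i).indicator (f i) (x i) := by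
    ext x
    by_cases hx : x ∈ Set.univ.pi s
    · rw [Set.indicator_of_mem hx]
      exact Finset.prod_congr rfl fun i _ => (Set.indicator_of_mem (hx i trivial) _).symm
    · rw [Set.indicator_of_notMem hx]
      obtain ⟨i, hi⟩ : ∃ i, x i ∉ s i := by simpa [Set.mem_pi] using hx
      exact (Finset.prod_eq_zero (Finset.mem_univ i) (Set.indicator_of_notMem hi _)).symm
  have hm : ∀ i, Measurable ((s i).indicator (f i)) := fun i => (hf i).indicator (hs i)
  rw [h1, lintegral_prod_eq_prod_lintegral_of_indepFun Finset.univ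
    (fun i (x : (i : ι) → X i) => (s i).indicator (f i) (x i))
    (iIndepFun_pi fun i => (hm i).aemeasurable) fun i => (hm i).comp (measurable_pi_apply i)]
  refine Finset.prod_congr rfl fun i _ => ?_
  rw [withDensity_apply _ (hs i), ← lintegral_indicator (hs i),
    ← lintegral_map (hm i) (measurable_pi_apply i), (measurePreserving_eval μ i).map_eq]

/-- The divergence between two Gaussian product measures of unit variance. -/
lemma klDiv_pi_gaussianReal {ι : Type*} [Fintype ι] (a : ι → ℝ) :
    InformationTheory.klDiv (Measure.pi fun i => gaussianReal (a i) 1)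
        (Measure.pi fun _ : ι => gaussianReal 0 1)
      = ENNReal.ofReal (1 / 2 * ∑ i, a i ^ 2) := by
  set ν : Measure (ι → ℝ) := Measure.pi fun _ : ι => gaussianReal 0 1 with hν
  set μ : Measure (ι → ℝ) := Measure.pi fun i => gaussianReal (a i) 1 with hμ
  have hd : μ = ν.withDensity fun x =>
      ENNReal.ofReal (Real.exp (∑ i, (a i * x i - a i ^ 2 / 2))) := by
    have : ∀ i : ι, SigmaFinite ((gaussianReal 0 1).withDensity
        fun x => ENNReal.ofReal (Real.exp (a i * x - a i ^ 2 / 2))) := fun i => by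
      rw [← gaussianReal_eq_withDensity_exp]; infer_instance
    rw [hμ, hν]
    simp_rw [gaussianReal_eq_withDensity_exp (a _)]
    rw [pi_withDensity_eq _ fun i => by fun_prop]
    congr 1
    ext x
    rw [Real.exp_sum, ENNReal.ofReal_prod_of_nonneg fun i _ => (Real.exp_pos _).le]
  have hac : μ ≪ ν := hd ▸ withDensity_absolutelyContinuous _ _
  have hllr : llr μ ν =ᵐ[μ] fun x => ∑ i, (a i * x i - a i ^ 2 / 2) := by
    have := hac.ae_le (Measure.rnDeriv_withDensity ν (f := fun x : ι → ℝ =>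
      ENNReal.ofReal (Real.exp (∑ i, (a i * x i - a i ^ 2 / 2)))) (by fun_prop))
    rw [← hd] at this
    filter_upwards [this] with x hx
    rw [llr, hx, ENNReal.toReal_ofReal (Real.exp_pos _).le, Real.log_exp]
  have hI : ∀ i, Integrable (fun x : ι → ℝ => x i) μ := fun i =>
    (measurePreserving_eval (fun i => gaussianReal (a i) 1) i).integrable_comp_of_integrable
      (g := id) ((memLp_id_gaussianReal 1).integrable le_rfl)
  have hI' : ∀ i ∈ Finset.univ, Integrable (fun x : ι → ℝ => a i * x i - a i ^ 2 / 2) μ :=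
    fun i _ => ((hI i).const_mul _).sub (integrable_const _)
  rw [InformationTheory.klDiv_of_ac_of_integrable hac
    ((integrable_congr hllr).2 (integrable_finsetSum _ hI')), integral_congr_ae hllr,
    integral_finsetSum _ hI']
  congr 1
  have hm : ∀ i, ∫ x : ι → ℝ, x i ∂μ = a i := fun i => by
    rw [hμ, integral_eval (μ := fun i => gaussianReal (a i) 1) (i := i)]
    simp
  -- Both total masses are 1, so the mass correction in `klDiv` vanishes. Each coordinate then
  -- contributes `a i * a i - a i ^ 2 / 2`.
  rw [probReal_univ, probReal_univ, add_sub_cancel_right, Finset.mul_sum]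
  refine Finset.sum_congr rfl fun i _ => ?_
  rw [integral_sub ((hI i).const_mul _) (integrable_const _), integral_const_mul, hm]
  simp
  ring

/-! ### Kalman recursion -/

namespace Model

variable {n p m p' m' : ℕ}

/-- The transition matrix `A - A K_k C` of the prediction error. -/
noncomputable def errorTransition (M : Model n p m) (k : ℕ) : Matrix (Fin n) (Fin n) ℝ :=
  M.A - M.A * M.gain k * M.C

lemma gain_mul_innovCov (M : Model n p m) {k : ℕ} (hk : IsUnit (M.innovCov k)) :
    M.gain k * M.innovCov k = M.predCov k * M.Cᵀ := by
  rw [gain, gainOf, ← innovCov, Matrix.mul_assoc,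
    Matrix.nonsing_inv_mul _ ((Matrix.isUnit_iff_isUnit_det _).1 hk), Matrix.mul_one]

/-- The prediction error at time `k + 1` is uncorrelated with the innovation at time `k`. -/
lemma errorTransition_mul_predCov_mul (M : Model n p m) {k : ℕ} (hk : IsUnit (M.innovCov k)) :
    M.errorTransition k * M.predCov k * M.Cᵀ = M.A * M.gain k * M.R := by
  -- With `F = A - A K C`, the covariance of `F e + w - A K v` with `C e + v` is `F P Cᵀ - A K R`;
  -- the gain equation makes it zero.
  have h := congrArg (M.A * ·) (M.gain_mul_innovCov hk)
  simp only [innovCov, innovOf, Matrix.mul_add, ← Matrix.mul_assoc] at h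
  rw [errorTransition, Matrix.sub_mul, Matrix.sub_mul, ← h]
  abel

/-- The Joseph form of the covariance recursion. -/
lemma predCov_succ_eq (M : Model n p m) {k : ℕ} (hk : IsUnit (M.innovCov k)) :
    M.predCov (k + 1) = M.errorTransition k * M.predCov k * (M.errorTransition k)ᵀ
      + M.A * M.gain k * M.R * (M.A * M.gain k)ᵀ + M.Q := by
  -- Expanding only the right factor leaves one correction, which decorrelation turns into the `R`
  -- term of the Joseph form.
  have h : M.errorTransition k * M.predCov k * (M.errorTransition k)ᵀ
      = M.errorTransition k * M.predCov k * M.Aᵀ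
        - M.errorTransition k * M.predCov k * M.Cᵀ * (M.A * M.gain k)ᵀ := by
    conv_lhs => rw [errorTransition.eq_def M k, Matrix.transpose_sub, Matrix.mul_sub,
      Matrix.transpose_mul _ M.C, ← Matrix.mul_assoc]
    rfl
  rw [h, M.errorTransition_mul_predCov_mul hk, errorTransition, predCov]
  simp only [Matrix.sub_mul, gain]
  abel

lemma innovOf_posSemidef (M : Model n p m) {P : Matrix (Fin n) (Fin n) ℝ} (hP : P.PosSemidef) :
    (M.innovOf P).PosSemidef := by
  have := hP.mul_mul_conjTranspose_same M.C
  rw [conjTranspose_eq_transpose_of_trivial] at this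
  exact this.add M.R_posSemidef

/-- The Joseph form is a sum of positive semidefinite terms, whereas the defining recursion contains
a difference. It requires invertibility only at earlier times. -/
lemma predCov_posSemidef (M : Model n p m) :
    ∀ k : ℕ, (∀ j < k, IsUnit (M.innovCov j)) → (M.predCov k).PosSemidef
  | 0, _ => M.P0_posSemidef
  | k + 1, h => by
    have h1 := (M.predCov_posSemidef k fun j hj => h j (hj.trans k.lt_succ_self)
      ).mul_mul_conjTranspose_same (M.errorTransition k)
    have h2 := M.R_posSemidef.mul_mul_conjTranspose_same (M.A * M.gain k)
    rw [conjTranspose_eq_transpose_of_trivial] at h1 h2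
    rw [M.predCov_succ_eq (h k k.lt_succ_self)]
    exact (h1.add h2).add M.Q_posSemidef

lemma innovCov_posSemidef (M : Model n p m) {k : ℕ} (h : ∀ j ≤ k, IsUnit (M.innovCov j)) :
    (M.innovCov k).PosSemidef :=
  M.innovOf_posSemidef (M.predCov_posSemidef k fun j hj => h j hj.le)

lemma sqrt_innovCov_mul_self (M : Model n p m) {k : ℕ} (h : ∀ j ≤ k, IsUnit (M.innovCov j)) :
    CFC.sqrt (M.innovCov k) * CFC.sqrt (M.innovCov k) = M.innovCov k :=
  CFC.sqrt_mul_sqrt_self _ (M.innovCov_posSemidef h).nonneg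

lemma isUnit_det_sqrt_innovCov (M : Model n p m) {k : ℕ} (h : ∀ j ≤ k, IsUnit (M.innovCov j)) :
    IsUnit (CFC.sqrt (M.innovCov k)).det := by
  have h1 := (Matrix.isUnit_iff_isUnit_det _).1 (h k le_rfl)
  rw [← M.sqrt_innovCov_mul_self h, Matrix.det_mul] at h1
  exact isUnit_of_mul_isUnit_left h1

lemma innovInvSqrt_mul_mul (M : Model n p m) {k : ℕ} (h : ∀ j ≤ k, IsUnit (M.innovCov j)) :
    M.innovInvSqrt k * M.innovCov k * M.innovInvSqrt k = 1 := by
  have hu := M.isUnit_det_sqrt_innovCov h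
  have hs := M.sqrt_innovCov_mul_self h
  rw [innovInvSqrt]
  generalize CFC.sqrt (M.innovCov k) = D at *
  rw [← hs, ← Matrix.mul_assoc, Matrix.nonsing_inv_mul _ hu, Matrix.one_mul,
    Matrix.mul_nonsing_inv _ hu]

/-- `CFC.sqrt` is nonnegative whatever its argument, so no invertibility is needed. -/
lemma innovInvSqrt_transpose (M : Model n p m) (k : ℕ) :
    (M.innovInvSqrt k)ᵀ = M.innovInvSqrt k := by
  have h1 : (CFC.sqrt (M.innovCov k)).PosSemidef :=
    Matrix.nonneg_iff_posSemidef.1 (CFC.sqrt_nonneg _)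
  rw [innovInvSqrt, Matrix.transpose_nonsing_inv, ← conjTranspose_eq_transpose_of_trivial,
    h1.isHermitian.eq]

/-- One step of the covariance recursion as an identity of quadratic forms: the innovation is
white and uncorrelated with the next prediction error. -/
lemma quadForm_step (M : Model n p m) {k : ℕ} (h : ∀ j ≤ k, IsUnit (M.innovCov j))
    (s : Fin n → ℝ) (t : Fin m → ℝ) :
    ((M.errorTransition k)ᵀ *ᵥ s + M.Cᵀ *ᵥ M.innovInvSqrt k *ᵥ t) ⬝ᵥ
          M.predCov k *ᵥ ((M.errorTransition k)ᵀ *ᵥ s + M.Cᵀ *ᵥ M.innovInvSqrt k *ᵥ t)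
        + (M.innovInvSqrt k *ᵥ t - (M.A * M.gain k)ᵀ *ᵥ s) ⬝ᵥ
          M.R *ᵥ (M.innovInvSqrt k *ᵥ t - (M.A * M.gain k)ᵀ *ᵥ s)
        + s ⬝ᵥ M.Q *ᵥ s
      = s ⬝ᵥ M.predCov (k + 1) *ᵥ s + t ⬝ᵥ t := by
  have hk := h k le_rfl
  have hP : (M.predCov k)ᵀ = M.predCov k := by
    rw [← conjTranspose_eq_transpose_of_trivial,
      (M.predCov_posSemidef k fun j hj => h j hj.le).isHermitian.eq]
  have hR : M.Rᵀ = M.R := by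
    rw [← conjTranspose_eq_transpose_of_trivial, M.R_posSemidef.isHermitian.eq]
  have hL := M.innovInvSqrt_transpose k
  have h2 := M.errorTransition_mul_predCov_mul hk
  have h2' := congrArg Matrix.transpose h2
  have h3 := M.innovInvSqrt_mul_mul h
  have h1 := M.predCov_succ_eq hk
  rw [innovCov, innovOf] at h3
  generalize M.errorTransition k = F at *
  generalize M.A * M.gain k = G at *
  generalize M.innovInvSqrt k = L at *
  generalize M.predCov k = P at *
  have tr : ∀ {a b : ℕ} (N : Matrix (Fin a) (Fin b) ℝ) (x : Fin a → ℝ) (y : Fin b → ℝ),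
      (Nᵀ *ᵥ x) ⬝ᵥ y = x ⬝ᵥ N *ᵥ y := fun N x y => by
    rw [Matrix.mulVec_transpose, ← Matrix.dotProduct_mulVec]
  have trL : ∀ x y : Fin m → ℝ, (L *ᵥ x) ⬝ᵥ y = x ⬝ᵥ L *ᵥ y := fun x y => by
    rw [← tr, hL]
  simp only [Matrix.transpose_mul, Matrix.transpose_transpose, hP, hR] at h2'
  have e1 : s ⬝ᵥ M.predCov (k + 1) *ᵥ s = s ⬝ᵥ F *ᵥ P *ᵥ Fᵀ *ᵥ s + s ⬝ᵥ G *ᵥ M.R *ᵥ Gᵀ *ᵥ s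
      + s ⬝ᵥ M.Q *ᵥ s := by
    rw [h1]; simp only [Matrix.add_mulVec, dotProduct_add, Matrix.mulVec_mulVec, Matrix.mul_assoc]
  -- The left side of the goal is the variance of `s ⬝ᵥ e_{k+1} + t ⬝ᵥ z_k`. By `e2` and its
  -- transpose `e3` the mixed terms through `P` cancel those through `R`; `e4` is the unit variance
  -- of the residue.
  have e2 : s ⬝ᵥ F *ᵥ P *ᵥ M.Cᵀ *ᵥ L *ᵥ t = s ⬝ᵥ G *ᵥ M.R *ᵥ L *ᵥ t := by
    have := congrArg (fun N => s ⬝ᵥ N *ᵥ L *ᵥ t) h2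
    simpa only [Matrix.mulVec_mulVec, Matrix.mul_assoc] using this
  have e3 : t ⬝ᵥ L *ᵥ M.C *ᵥ P *ᵥ Fᵀ *ᵥ s = t ⬝ᵥ L *ᵥ M.R *ᵥ Gᵀ *ᵥ s := by
    have := congrArg (fun N => t ⬝ᵥ L *ᵥ N *ᵥ s) h2'
    simpa only [Matrix.mulVec_mulVec, Matrix.mul_assoc] using this
  have e4 : t ⬝ᵥ L *ᵥ M.C *ᵥ P *ᵥ M.Cᵀ *ᵥ L *ᵥ t + t ⬝ᵥ L *ᵥ M.R *ᵥ L *ᵥ t = t ⬝ᵥ t := by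
    have := congrArg (fun N => t ⬝ᵥ N *ᵥ t) h3
    simpa only [Matrix.mulVec_mulVec, Matrix.mul_assoc, Matrix.mul_add, Matrix.add_mul,
      Matrix.add_mulVec, dotProduct_add, Matrix.one_mulVec] using this
  rw [e1, ← e4]
  simp only [add_dotProduct, sub_dotProduct, Matrix.mulVec_add, Matrix.mulVec_sub, dotProduct_add,
    dotProduct_sub, tr, trL]
  linarith

/-! ### The closed loop and its prediction error -/

section Sample

variable (M : Model n p m) (S : Channels n m p' m') (ctrl : DefenderStrategy p m)
  (att : FDIPolicy p' m') (ω : Noise n m)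

lemma sample_zero_x : (M.sample S ctrl att ω 0).x = ω.1 := by
  rw [sample.eq_def]

lemma sample_succ_x (k : ℕ) : (M.sample S ctrl att ω (k + 1)).x
    = M.A *ᵥ (M.sample S ctrl att ω k).x + M.B *ᵥ (M.sample S ctrl att ω k).u
      + S.Ba *ᵥ att.uInput k + ω.2.1 k := by
  rw [sample]
  rfl

lemma sample_y (k : ℕ) : (M.sample S ctrl att ω k).y
    = M.C *ᵥ (M.sample S ctrl att ω k).x + S.Da *ᵥ att.dInput k + ω.2.2 k := by
  have h := sample.eq_def M S ctrl att ω k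
  rw [congrArg Sample.y h, congrArg Sample.x h]

end Sample

lemma snoc_castSucc_eq {α : Type*} (y : ℕ → α) (k : ℕ) :
    Fin.snoc (α := fun _ => α) (fun i : Fin k => y i) (y k) = fun i : Fin (k + 1) => y i := by
  ext i
  refine Fin.lastCases ?_ (fun i => ?_) i
  · simp
  · simp

lemma sample_u (M : Model n p m) (S : Channels n m p' m') (ctrl : DefenderStrategy p m)
    (att : FDIPolicy p' m') (ω : Noise n m) (k : ℕ) :
    (M.sample S ctrl att ω k).u = ctrl.toFun k (fun i => (M.sample S ctrl att ω i).y)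
      (fun i => (M.sample S ctrl att ω i).u) := by
  have h := sample.eq_def M S ctrl att ω k
  have hy := congrArg Sample.y h
  have hu := congrArg Sample.u h
  dsimp only at hy hu
  rw [hu, ← hy, snoc_castSucc_eq fun k => (M.sample S ctrl att ω k).y]

/-- The prediction error in normal operation, as a function of the noise only. -/
noncomputable def noiseError (M : Model n p m) (ω : Noise n m) : ℕ → Fin n → ℝ
  | 0 => ω.1 - M.xhat0
  | k + 1 => M.errorTransition k *ᵥ M.noiseError ω k + ω.2.1 k - (M.A * M.gain k) *ᵥ ω.2.2 k

/-- The normalized residue in normal operation, as a function of the noise only. -/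
noncomputable def noiseResidue (M : Model n p m) (ω : Noise n m) (k : ℕ) : Fin m → ℝ :=
  M.innovInvSqrt k *ᵥ (M.C *ᵥ M.noiseError ω k + ω.2.2 k)

/-- The terms `B u_k` cancel, so however nonlinear the feedback is, the error is linear in noise and
attack and the two effects superpose. -/
lemma sample_x_sub_predict (M : Model n p m) (S : Channels n m p' m')
    (ctrl : DefenderStrategy p m) (att : FDIPolicy p' m') (ω : Noise n m) (k : ℕ) :
    (M.sample S ctrl att ω k).x - M.predict (fun j => (M.sample S ctrl att ω j).y)
        (fun j => (M.sample S ctrl att ω j).u) k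
      = M.noiseError ω k + M.errorBias S att k := by
  induction k with
  | zero => simp [sample_zero_x, predict, noiseError, errorBias]
  | succ k ih =>
    rw [sample_succ_x, predict, noiseError, errorBias, sample_y, errorTransition]
    rw [sub_eq_iff_eq_add] at ih
    rw [ih]
    simp only [Matrix.mulVec_add, Matrix.sub_mulVec, Matrix.one_mulVec,
      Matrix.mulVec_sub, Matrix.mulVec_mulVec, Matrix.mul_assoc]
    abel

lemma residue_eq_noiseResidue_add (M : Model n p m) (S : Channels n m p' m')
    (ctrl : DefenderStrategy p m) (att : FDIPolicy p' m') (ω : Noise n m) (k : ℕ) :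
    M.residue S ctrl att ω k = M.noiseResidue ω k + M.residueBias S att k := by
  have h := M.sample_x_sub_predict S ctrl att ω k
  rw [sub_eq_iff_eq_add] at h
  rw [residue, noiseResidue, residueBias, sample_y, h, ← Matrix.mulVec_add]
  congr 1
  simp only [Matrix.mulVec_add]
  abel

lemma errorBias_none (M : Model n p m) (S : Channels n m p' m') (k : ℕ) :
    M.errorBias S FDIPolicy.none k = 0 := by
  induction k with
  | zero => rfl
  | succ k ih =>
    rw [errorBias, ih]
    simp [FDIPolicy.uInput, FDIPolicy.dInput, FDIPolicy.inputs, FDIPolicy.none]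

lemma residueBias_none (M : Model n p m) (S : Channels n m p' m') (k : ℕ) :
    M.residueBias S FDIPolicy.none k = 0 := by
  rw [residueBias, errorBias_none]
  simp [FDIPolicy.dInput, FDIPolicy.inputs, FDIPolicy.none]

/-! ### The law of the residues in normal operation -/

/-- A linear form in the prediction error and the past residues is a linear form in the noise,
with the variance that the error covariance and white residues predict. -/
lemma exists_noise_coefficients (M : Model n p m) (t : ℕ → Fin m → ℝ) :
    ∀ k : ℕ, (∀ j < k, IsUnit (M.innovCov j)) → ∀ s : Fin n → ℝ,
      ∃ (a : Fin n → ℝ) (b : ℕ → Fin n → ℝ) (c : ℕ → Fin m → ℝ),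
        (∀ ω : Noise n m, s ⬝ᵥ M.noiseError ω k + ∑ j ∈ Finset.range k, t j ⬝ᵥ M.noiseResidue ω j
          = a ⬝ᵥ (ω.1 - M.xhat0) + ∑ j ∈ Finset.range k, b j ⬝ᵥ ω.2.1 j
            + ∑ j ∈ Finset.range k, c j ⬝ᵥ ω.2.2 j) ∧
        a ⬝ᵥ M.P0 *ᵥ a + ∑ j ∈ Finset.range k, b j ⬝ᵥ M.Q *ᵥ b j
            + ∑ j ∈ Finset.range k, c j ⬝ᵥ M.R *ᵥ c j
          = s ⬝ᵥ M.predCov k *ᵥ s + ∑ j ∈ Finset.range k, t j ⬝ᵥ t j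
  | 0, _, s => ⟨s, 0, 0, by simp [noiseError], by simp [predCov]⟩
  | k + 1, h, s => by
    have hk : ∀ j ≤ k, IsUnit (M.innovCov j) := fun j hj => h j (Nat.lt_succ_of_le hj)
    -- The vector is the coefficient of `e_k` in `s ⬝ᵥ e_{k+1} + t_k ⬝ᵥ z_k`. Since it differs from
    -- `s`, the induction runs over all `s`. The new coefficients of `w_k` and `v_k` are written at
    -- index `k`, which `upd` shows not to disturb the earlier sums.
    obtain ⟨a, b, c, h1, h2⟩ := M.exists_noise_coefficients t k (fun j hj => hk j hj.le)
      ((M.errorTransition k)ᵀ *ᵥ s + M.Cᵀ *ᵥ M.innovInvSqrt k *ᵥ t k)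
    have tr : ∀ {a b : ℕ} (N : Matrix (Fin a) (Fin b) ℝ) (x : Fin a → ℝ) (y : Fin b → ℝ),
        (Nᵀ *ᵥ x) ⬝ᵥ y = x ⬝ᵥ N *ᵥ y := fun N x y => by
      rw [Matrix.mulVec_transpose, ← Matrix.dotProduct_mulVec]
    have trL : ∀ x y : Fin m → ℝ,
        (M.innovInvSqrt k *ᵥ x) ⬝ᵥ y = x ⬝ᵥ M.innovInvSqrt k *ᵥ y := fun x y => by
      rw [← tr, M.innovInvSqrt_transpose k]
    have upd : ∀ {α : Type} (f : ℕ → α) (v : α) (g : ℕ → α → ℝ),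
        ∑ j ∈ Finset.range k, g j (Function.update f k v j)
          = ∑ j ∈ Finset.range k, g j (f j) := fun f v g =>
      Finset.sum_congr rfl fun j hj => by
        rw [Function.update_of_ne (Finset.mem_range.1 hj).ne]
    refine ⟨a, Function.update b k s, Function.update c k
      (M.innovInvSqrt k *ᵥ t k - (M.A * M.gain k)ᵀ *ᵥ s), fun ω => ?_, ?_⟩
    · have h1 := h1 ω
      simp only [Finset.sum_range_succ, Function.update_self]
      rw [upd _ _ fun j v => v ⬝ᵥ ω.2.1 j, upd _ _ fun j v => v ⬝ᵥ ω.2.2 j, noiseError]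
      have h3 : t k ⬝ᵥ M.noiseResidue ω k
          = t k ⬝ᵥ M.innovInvSqrt k *ᵥ M.C *ᵥ M.noiseError ω k
            + t k ⬝ᵥ M.innovInvSqrt k *ᵥ ω.2.2 k := by
        rw [noiseResidue, Matrix.mulVec_add, dotProduct_add]
      rw [h3]
      simp only [add_dotProduct, sub_dotProduct, dotProduct_add, dotProduct_sub, tr, trL] at h1 ⊢
      linarith
    · have h3 := M.quadForm_step hk s (t k)
      simp only [Finset.sum_range_succ, Function.update_self]
      rw [upd _ _ fun j v => v ⬝ᵥ M.Q *ᵥ v, upd _ _ fun j v => v ⬝ᵥ M.R *ᵥ v]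
      linarith

end Model

/-! ### Characteristic functions of the noise -/

instance isProbabilityMeasure_gaussianLaw {ι : Type} [Fintype ι] [DecidableEq ι]
    (μ : ι → ℝ) (Sig : Matrix ι ι ℝ) : IsProbabilityMeasure (gaussianLaw μ Sig) :=
  Measure.isProbabilityMeasure_map (by fun_prop)

/-- Centring at `μ` cancels the phase of the characteristic function and leaves only the variance of
the linear form. -/
lemma integral_cexp_gaussianLaw {ι : Type} [Fintype ι] [DecidableEq ι]
    (μ : ι → ℝ) {Sig : Matrix ι ι ℝ} (hS : Sig.PosSemidef) (b : ι → ℝ) :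
    ∫ x, Complex.exp (((b ⬝ᵥ (x - μ) : ℝ) : ℂ) * Complex.I) ∂gaussianLaw μ Sig
      = Complex.exp (-((b ⬝ᵥ Sig *ᵥ b : ℝ) : ℂ) / 2) := by
  have h := charFun_multivariateGaussian (μ := WithLp.toLp 2 μ) hS (WithLp.toLp 2 b)
  rw [charFun_apply] at h
  have e : ∀ x : EuclideanSpace ℝ ι,
      Complex.exp (((b ⬝ᵥ (x.ofLp - μ) : ℝ) : ℂ) * Complex.I)
        = Complex.exp (-((b ⬝ᵥ μ : ℝ) : ℂ) * Complex.I)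
          * Complex.exp (((inner ℝ x (WithLp.toLp 2 b) : ℝ) : ℂ) * Complex.I) := fun x => by
    rw [← Complex.exp_add, ← add_mul, EuclideanSpace.inner_eq_star_dotProduct, dotProduct_sub]
    congr 2
    simp
    ring
  rw [gaussianLaw, integral_map (by fun_prop) (by fun_prop)]
  simp_rw [e]
  rw [integral_const_mul, h, ← Complex.exp_add, EuclideanSpace.inner_eq_star_dotProduct]
  congr 1
  simp [dotProduct_comm μ b]
  ring

lemma integral_cexp_infinitePi_gaussianLaw {ι : Type} [Fintype ι] [DecidableEq ι]
    {Sig : Matrix ι ι ℝ} (hS : Sig.PosSemidef) (b : ℕ → ι → ℝ) (k : ℕ) :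
    ∫ w, Complex.exp (((∑ j ∈ Finset.range k, b j ⬝ᵥ w j : ℝ) : ℂ) * Complex.I)
        ∂(Measure.infinitePi fun _ : ℕ => gaussianLaw 0 Sig)
      = Complex.exp (-((∑ j ∈ Finset.range k, b j ⬝ᵥ Sig *ᵥ b j : ℝ) : ℂ) / 2) := by
  -- Only the coordinates below `k` occur, so the integral descends to a finite product. The `- 0`
  -- matches the centred form of `integral_cexp_gaussianLaw`.
  have e : ∀ w : ℕ → ι → ℝ,
      Complex.exp (((∑ j ∈ Finset.range k, b j ⬝ᵥ w j : ℝ) : ℂ) * Complex.I)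
        = (fun y : Finset.range k → ι → ℝ =>
            ∏ j : Finset.range k, Complex.exp (((b j ⬝ᵥ (y j - 0) : ℝ) : ℂ) * Complex.I))
          ((Finset.range k).restrict w) := fun w => by
    simp only [sub_zero, Finset.restrict]
    rw [← Complex.exp_sum, ← Finset.sum_mul, ← Complex.ofReal_sum,
      Finset.sum_coe_sort (Finset.range k) fun j => b j ⬝ᵥ w j]
  refine (integral_congr_ae (ae_of_all _ e)).trans ?_
  refine (integral_restrict_infinitePi (X := fun _ : ℕ => ι → ℝ) (fun _ : ℕ => gaussianLaw 0 Sig)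
    (f := fun y => ∏ j : Finset.range k,
      Complex.exp (((b j ⬝ᵥ (y j - 0) : ℝ) : ℂ) * Complex.I))
    (Measurable.aestronglyMeasurable (by unfold dotProduct; fun_prop))).trans ?_
  rw [integral_fintype_prod_eq_prod (𝕜 := ℂ) (fun (j : Finset.range k) (x : ι → ℝ) =>
      Complex.exp (((b j ⬝ᵥ (x - 0) : ℝ) : ℂ) * Complex.I))]
  simp_rw [integral_cexp_gaussianLaw 0 hS]
  rw [← Complex.exp_sum, ← Finset.sum_div, Finset.sum_neg_distrib, ← Complex.ofReal_sum,
    Finset.sum_coe_sort (Finset.range k) fun j => b j ⬝ᵥ Sig *ᵥ b j]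

namespace Model

variable {n p m p' m' : ℕ}

instance isProbabilityMeasure_noiseLaw (M : Model n p m) : IsProbabilityMeasure M.noiseLaw := by
  unfold noiseLaw
  infer_instance

/-- The characteristic function of finitely many noise terms. -/
lemma integral_cexp_noiseLaw (M : Model n p m) (a : Fin n → ℝ) (b : ℕ → Fin n → ℝ)
    (c : ℕ → Fin m → ℝ) (k : ℕ) :
    ∫ ω, Complex.exp (((a ⬝ᵥ (ω.1 - M.xhat0) + ∑ j ∈ Finset.range k, b j ⬝ᵥ ω.2.1 j
        + ∑ j ∈ Finset.range k, c j ⬝ᵥ ω.2.2 j : ℝ) : ℂ) * Complex.I) ∂M.noiseLaw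
      = Complex.exp (-((a ⬝ᵥ M.P0 *ᵥ a + ∑ j ∈ Finset.range k, b j ⬝ᵥ M.Q *ᵥ b j
            + ∑ j ∈ Finset.range k, c j ⬝ᵥ M.R *ᵥ c j : ℝ) : ℂ) / 2) := by
  have e : ∀ ω : Noise n m, Complex.exp (((a ⬝ᵥ (ω.1 - M.xhat0)
        + ∑ j ∈ Finset.range k, b j ⬝ᵥ ω.2.1 j
        + ∑ j ∈ Finset.range k, c j ⬝ᵥ ω.2.2 j : ℝ) : ℂ) * Complex.I)
      = Complex.exp (((a ⬝ᵥ (ω.1 - M.xhat0) : ℝ) : ℂ) * Complex.I) *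
        (Complex.exp (((∑ j ∈ Finset.range k, b j ⬝ᵥ ω.2.1 j : ℝ) : ℂ) * Complex.I) *
          Complex.exp (((∑ j ∈ Finset.range k, c j ⬝ᵥ ω.2.2 j : ℝ) : ℂ) * Complex.I)) :=
    fun ω => by
      rw [← Complex.exp_add, ← Complex.exp_add]
      congr 1
      push_cast
      ring
  simp_rw [e]
  rw [noiseLaw, integral_prod_mul (fun x : Fin n → ℝ =>
      Complex.exp (((a ⬝ᵥ (x - M.xhat0) : ℝ) : ℂ) * Complex.I))
      (fun ω' : (ℕ → Fin n → ℝ) × (ℕ → Fin m → ℝ) =>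
      Complex.exp (((∑ j ∈ Finset.range k, b j ⬝ᵥ ω'.1 j : ℝ) : ℂ) * Complex.I) *
        Complex.exp (((∑ j ∈ Finset.range k, c j ⬝ᵥ ω'.2 j : ℝ) : ℂ) * Complex.I)),
    integral_prod_mul (fun w : ℕ → Fin n → ℝ =>
      Complex.exp (((∑ j ∈ Finset.range k, b j ⬝ᵥ w j : ℝ) : ℂ) * Complex.I))
      (fun v : ℕ → Fin m → ℝ =>
      Complex.exp (((∑ j ∈ Finset.range k, c j ⬝ᵥ v j : ℝ) : ℂ) * Complex.I)),
    integral_cexp_gaussianLaw _ M.P0_posSemidef,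
    integral_cexp_infinitePi_gaussianLaw M.Q_posSemidef,
    integral_cexp_infinitePi_gaussianLaw M.R_posSemidef, ← Complex.exp_add, ← Complex.exp_add]
  congr 1
  push_cast
  ring

lemma measurable_mulVec {Ω ι κ : Type*} [MeasurableSpace Ω] [Fintype ι] [Fintype κ]
    (N : Matrix ι κ ℝ) {f : Ω → κ → ℝ} (hf : Measurable f) :
    Measurable fun ω => N *ᵥ f ω :=
  (Continuous.matrix_mulVec continuous_const continuous_id).measurable.comp hf

lemma measurable_noiseError (M : Model n p m) (k : ℕ) :
    Measurable fun ω => M.noiseError ω k := by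
  induction k with
  | zero => exact measurable_fst.sub_const _
  | succ k ih =>
    exact ((measurable_mulVec _ ih).add (by fun_prop)).sub (measurable_mulVec _ (by fun_prop))

lemma measurable_noiseResidue (M : Model n p m) (k : ℕ) :
    Measurable fun ω => M.noiseResidue ω k :=
  measurable_mulVec _ ((measurable_mulVec _ (M.measurable_noiseError k)).add (by fun_prop))

/-- In normal operation the normalized residues are independent standard Gaussian vectors. -/
lemma map_noiseResidue (M : Model n p m) (T : ℕ) (h : ∀ k ≤ T, IsUnit (M.innovCov k)) :
    M.noiseLaw.map (fun ω (i : Fin (T + 1) × Fin m) => M.noiseResidue ω i.1 i.2)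
      = Measure.pi fun _ => gaussianReal 0 1 := by
  have hm : Measurable fun ω (i : Fin (T + 1) × Fin m) => M.noiseResidue ω i.1 i.2 :=
    measurable_pi_iff.2 fun i => (measurable_pi_apply i.2).comp (M.measurable_noiseResidue i.1)
  have : IsProbabilityMeasure (M.noiseLaw.map
      fun ω (i : Fin (T + 1) × Fin m) => M.noiseResidue ω i.1 i.2) :=
    Measure.isProbabilityMeasure_map hm.aemeasurable
  refine charFun_eq_pi_iff.1 fun t => ?_
  let t' : ℕ → Fin m → ℝ := fun k i => if hk : k < T + 1 then t (⟨k, hk⟩, i) else 0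
  have ht' : ∀ (k : Fin (T + 1)) i, t' k i = t (k, i) := fun k i => dif_pos k.2
  -- Taking `s = 0` drops the error term, and `T + 1` includes the residue at time `T`. The variance
  -- reduces to `∑ t' j ⬝ᵥ t' j`, as for a standard Gaussian vector.
  obtain ⟨a, b, c, h1, h2⟩ := M.exists_noise_coefficients t' (T + 1)
    (fun j hj => h j (Nat.lt_succ_iff.1 hj)) 0
  have e : ∀ ω, inner ℝ (WithLp.toLp 2 fun i : Fin (T + 1) × Fin m => M.noiseResidue ω i.1 i.2) t
      = ∑ j ∈ Finset.range (T + 1), t' j ⬝ᵥ M.noiseResidue ω j := fun ω => by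
    rw [EuclideanSpace.inner_eq_star_dotProduct, Finset.sum_range, dotProduct,
      Fintype.sum_prod_type]
    simp [dotProduct, ht']
  rw [charFun_apply, integral_map (by fun_prop) (by fun_prop),
    integral_map hm.aemeasurable (by fun_prop)]
  simp_rw [e]
  simp only [zero_dotProduct, zero_add] at h1 h2
  simp_rw [h1]
  rw [integral_cexp_noiseLaw, h2, Finset.sum_range]
  simp_rw [charFun_gaussianReal]
  rw [← Complex.exp_sum, Fintype.sum_prod_type]
  simp [dotProduct, ht', Finset.sum_div, ← sq, neg_div]

/-! ### Reconstruction of the outputs from the residues -/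

/-- The closed loop in innovations form: it is driven by the normalized residues `z`, and its state
is the Kalman prediction. -/
noncomputable def innovLoop (M : Model n p m) (ctrl : DefenderStrategy p m)
    (z : ℕ → Fin m → ℝ) (k : ℕ) : Sample n p m :=
  let past : Fin k → Sample n p m := fun i => innovLoop M ctrl z i
  let xNow : Fin n → ℝ :=
    match k, past with
    | 0, _ => M.xhat0
    | j + 1, past =>
      M.A *ᵥ ((1 - M.gain j * M.C) *ᵥ (past (Fin.last j)).x
        + M.gain j *ᵥ (past (Fin.last j)).y) + M.B *ᵥ (past (Fin.last j)).u
  let yNow : Fin m → ℝ := CFC.sqrt (M.innovCov k) *ᵥ z k + M.C *ᵥ xNow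
  { x := xNow
    y := yNow
    u := ctrl.toFun k (Fin.snoc (α := fun _ => Fin m → ℝ) (fun i => (past i).y) yNow)
      (fun i => (past i).u) }
termination_by k
decreasing_by exact i.2

/-- The sequences `x, y, u` are compatible: `x` is the Kalman prediction from `y` and `u`, and `u`
results from the control strategy. -/
structure IsFilterLoop (M : Model n p m) (ctrl : DefenderStrategy p m) (x : ℕ → Fin n → ℝ)
    (y : ℕ → Fin m → ℝ) (u : ℕ → Fin p → ℝ) : Prop where
  zero : x 0 = M.xhat0
  succ : ∀ k, x (k + 1) = M.A *ᵥ ((1 - M.gain k * M.C) *ᵥ x k + M.gain k *ᵥ y k) + M.B *ᵥ u k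
  input : ∀ k, u k = ctrl.toFun k (fun i => y i) (fun i => u i)

/-- Outputs need only agree once the predictions do. This covers both recovering residues from equal
outputs and rebuilding outputs from equal residues. -/
lemma IsFilterLoop.eq_of_output {M : Model n p m} {ctrl : DefenderStrategy p m}
    {x x' : ℕ → Fin n → ℝ} {y y' : ℕ → Fin m → ℝ} {u u' : ℕ → Fin p → ℝ}
    (h : M.IsFilterLoop ctrl x y u) (h' : M.IsFilterLoop ctrl x' y' u') {T : ℕ}
    (hy : ∀ k ≤ T, x k = x' k → y k = y' k) :
    ∀ k ≤ T, x k = x' k ∧ y k = y' k ∧ u k = u' k := by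
  intro k
  induction k using Nat.strong_induction_on with
  | _ k ih =>
    intro hk
    have hx : x k = x' k := by
      cases k with
      | zero => rw [h.zero, h'.zero]
      | succ j =>
        obtain ⟨h1, h2, h3⟩ := ih j j.lt_succ_self (j.le_succ.trans hk)
        rw [h.succ, h'.succ, h1, h2, h3]
    have hyk := hy k hk hx
    refine ⟨hx, hyk, ?_⟩
    rw [h.input, h'.input]
    congr 1
    · ext1 i
      rcases Nat.lt_succ_iff_lt_or_eq.1 i.2 with hi | hi
      · exact (ih i hi (hi.le.trans hk)).2.1
      · rw [hi]; exact hyk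
    · ext1 i
      exact (ih i i.2 (i.2.le.trans hk)).2.2

lemma innovLoop_y (M : Model n p m) (ctrl : DefenderStrategy p m) (z : ℕ → Fin m → ℝ) (k : ℕ) :
    (M.innovLoop ctrl z k).y
      = CFC.sqrt (M.innovCov k) *ᵥ z k + M.C *ᵥ (M.innovLoop ctrl z k).x := by
  have h := innovLoop.eq_def M ctrl z k
  rw [congrArg Sample.y h, congrArg Sample.x h]

lemma isFilterLoop_innovLoop (M : Model n p m) (ctrl : DefenderStrategy p m)
    (z : ℕ → Fin m → ℝ) :
    M.IsFilterLoop ctrl (fun k => (M.innovLoop ctrl z k).x) (fun k => (M.innovLoop ctrl z k).y)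
      (fun k => (M.innovLoop ctrl z k).u) where
  zero := by
    rw [innovLoop.eq_def]
  succ k := by
    rw [innovLoop]
    rfl
  input k := by
    have h := innovLoop.eq_def M ctrl z k
    have hy := congrArg Sample.y h
    have hu := congrArg Sample.u h
    dsimp only at hy hu
    rw [hu, ← hy, snoc_castSucc_eq fun k => (M.innovLoop ctrl z k).y]

lemma isFilterLoop_sample (M : Model n p m) (S : Channels n m p' m') (ctrl : DefenderStrategy p m)
    (att : FDIPolicy p' m') (ω : Noise n m) :
    M.IsFilterLoop ctrl
      (M.predict (fun j => (M.sample S ctrl att ω j).y) fun j => (M.sample S ctrl att ω j).u)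
      (fun k => (M.sample S ctrl att ω k).y) (fun k => (M.sample S ctrl att ω k).u) where
  zero := rfl
  succ _ := rfl
  input k := M.sample_u S ctrl att ω k

/-- Measurability of the control strategy enters here; the induction is strong because the strategy
reads the whole past. -/
lemma measurable_innovLoop (M : Model n p m) (ctrl : DefenderStrategy p m) {Ω : Type*}
    [MeasurableSpace Ω] {Z : Ω → ℕ → Fin m → ℝ} (hZ : ∀ k, Measurable fun ω => Z ω k) (k : ℕ) :
    (Measurable fun ω => (M.innovLoop ctrl (Z ω) k).x) ∧
    (Measurable fun ω => (M.innovLoop ctrl (Z ω) k).y) ∧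
    (Measurable fun ω => (M.innovLoop ctrl (Z ω) k).u) := by
  induction k using Nat.strong_induction_on with
  | _ k ih =>
    have hx : Measurable fun ω => (M.innovLoop ctrl (Z ω) k).x := by
      cases k with
      | zero =>
        simp_rw [(M.isFilterLoop_innovLoop ctrl (Z _)).zero]
        exact measurable_const
      | succ j =>
        obtain ⟨h1, h2, h3⟩ := ih j j.lt_succ_self
        simp_rw [(M.isFilterLoop_innovLoop ctrl (Z _)).succ]
        exact (measurable_mulVec _ ((measurable_mulVec _ h1).add (measurable_mulVec _ h2))).add
          (measurable_mulVec _ h3)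
    have hy : Measurable fun ω => (M.innovLoop ctrl (Z ω) k).y := by
      simp_rw [innovLoop_y]
      exact (measurable_mulVec _ (hZ k)).add (measurable_mulVec _ hx)
    refine ⟨hx, hy, ?_⟩
    simp_rw [(M.isFilterLoop_innovLoop ctrl (Z _)).input k]
    refine (ctrl.measurable' k).comp (f := fun ω => (_, _)) (.prodMk ?_ ?_)
    · refine measurable_pi_iff.2 fun i => ?_
      rcases Nat.lt_succ_iff_lt_or_eq.1 i.2 with hi | hi
      · exact (ih i hi).2.1
      · simp_rw [hi]; exact hy
    · exact measurable_pi_iff.2 fun i => (ih i i.2).2.2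

/-- Extension of finitely many residues by zero. -/
def extendResidue {T : ℕ} (r : Fin (T + 1) × Fin m → ℝ) (k : ℕ) (i : Fin m) : ℝ :=
  if hk : k < T + 1 then r (⟨k, hk⟩, i) else 0

lemma extendResidue_of_le {T : ℕ} (r : Fin (T + 1) × Fin m → ℝ) {k : ℕ} (hk : k ≤ T) (i : Fin m) :
    extendResidue r k i = r (⟨k, Nat.lt_succ_of_le hk⟩, i) :=
  dif_pos _

/-- The outputs `y_{0:T}` as a function of the normalized residues `z_{0:T}`. -/
noncomputable def outputOfResidue (M : Model n p m) (ctrl : DefenderStrategy p m) (T : ℕ)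
    (r : Fin (T + 1) × Fin m → ℝ) (k : Fin (T + 1)) : Fin m → ℝ :=
  (M.innovLoop ctrl (extendResidue r) k).y

lemma measurable_outputOfResidue (M : Model n p m) (ctrl : DefenderStrategy p m) (T : ℕ) :
    Measurable (M.outputOfResidue ctrl T) := by
  refine measurable_pi_iff.2 fun k => (M.measurable_innovLoop ctrl (fun j => ?_) k).2.1
  refine measurable_pi_iff.2 fun i => ?_
  unfold extendResidue
  split_ifs
  · exact measurable_pi_apply _
  · exact measurable_const

/-- Equal outputs force equal inputs and predictions, hence equal innovations; the invertible square
root of the innovation covariance then gives equal residues. -/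
lemma injective_outputOfResidue (M : Model n p m) (ctrl : DefenderStrategy p m) {T : ℕ}
    (h : ∀ k ≤ T, IsUnit (M.innovCov k)) :
    Function.Injective (M.outputOfResidue ctrl T) := by
  intro r r' hr
  have hy : ∀ k ≤ T, (M.innovLoop ctrl (extendResidue r) k).y
      = (M.innovLoop ctrl (extendResidue r') k).y := fun k hk =>
    congrFun hr ⟨k, Nat.lt_succ_of_le hk⟩
  have hx := (M.isFilterLoop_innovLoop ctrl (extendResidue r)).eq_of_output
    (M.isFilterLoop_innovLoop ctrl (extendResidue r')) fun k hk _ => hy k hk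
  ext ⟨k, i⟩
  have hk : (k : ℕ) ≤ T := Nat.lt_succ_iff.1 k.2
  have h1 := hy k hk
  rw [innovLoop_y, innovLoop_y, (hx k hk).1, add_left_inj] at h1
  have hinj := Matrix.mulVec_injective_of_isUnit ((Matrix.isUnit_iff_isUnit_det _).2
    (M.isUnit_det_sqrt_innovCov fun j hj => h j (hj.trans hk)))
  simpa [extendResidue_of_le _ hk] using congrFun (hinj h1) i

/-- The filter sees the attack only through `y`, so undoing the normalization and adding back the
prediction works with the same map for every attack. -/
lemma outputOfResidue_residue (M : Model n p m) (S : Channels n m p' m')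
    (ctrl : DefenderStrategy p m) (att : FDIPolicy p' m') {T : ℕ}
    (h : ∀ k ≤ T, IsUnit (M.innovCov k)) (ω : Noise n m) :
    (fun k : Fin (T + 1) => (M.sample S ctrl att ω k).y)
      = M.outputOfResidue ctrl T fun i => M.residue S ctrl att ω i.1 i.2 := by
  ext1 k
  refine ((M.isFilterLoop_sample S ctrl att ω).eq_of_output (M.isFilterLoop_innovLoop ctrl _)
    (fun j hj hx => ?_) k (Nat.lt_succ_iff.1 k.2)).2.1
  have hr : extendResidue (fun i : Fin (T + 1) × Fin m => M.residue S ctrl att ω i.1 i.2) j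
      = M.residue S ctrl att ω j := by
    ext i
    rw [extendResidue_of_le _ hj]
  rw [innovLoop_y, ← hx, hr, residue, innovInvSqrt, Matrix.mulVec_mulVec,
    Matrix.mul_nonsing_inv _ (M.isUnit_det_sqrt_innovCov fun i hi => h i (hi.trans hj)),
    Matrix.one_mulVec, sub_add_cancel]

/-- The outputs under attack are the image of Gaussian residues of unit covariance, whose mean is
the residue bias. -/
lemma outputLaw_eq_map (M : Model n p m) (S : Channels n m p' m') (ctrl : DefenderStrategy p m)
    (att : FDIPolicy p' m') {T : ℕ} (h : ∀ k ≤ T, IsUnit (M.innovCov k)) :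
    M.outputLaw S ctrl att T
      = (Measure.pi fun i : Fin (T + 1) × Fin m =>
          gaussianReal (M.residueBias S att i.1 i.2) 1).map (M.outputOfResidue ctrl T) := by
  have hm : Measurable fun ω (i : Fin (T + 1) × Fin m) => M.noiseResidue ω i.1 i.2 :=
    measurable_pi_iff.2 fun i => (measurable_pi_apply i.2).comp (M.measurable_noiseResidue i.1)
  have hg : Measurable fun (r : Fin (T + 1) × Fin m → ℝ) i =>
      r i + M.residueBias S att i.1 i.2 := by fun_prop
  -- Shifting the white residues by the deterministic bias moves the mean and keeps unit variance.
  have h1 : (Measure.pi fun i : Fin (T + 1) × Fin m =>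
      gaussianReal (M.residueBias S att i.1 i.2) 1)
      = (M.noiseLaw.map fun ω (i : Fin (T + 1) × Fin m) => M.noiseResidue ω i.1 i.2).map
          fun r i => r i + M.residueBias S att i.1 i.2 := by
    rw [M.map_noiseResidue T h, Measure.pi_map_pi (f := fun (i : Fin (T + 1) × Fin m) x =>
      x + M.residueBias S att i.1 i.2) fun i => by fun_prop]
    simp_rw [gaussianReal_map_add_const, zero_add]
  rw [h1, Measure.map_map hg hm, Measure.map_map (M.measurable_outputOfResidue ctrl T)
    (hg.comp hm), outputLaw]
  congr 1
  ext1 ω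
  rw [M.outputOfResidue_residue S ctrl att h ω]
  simp_rw [residue_eq_noiseResidue_add]
  rfl

end Model

end CPS

theorem mainTheorem1 {n p m p' m' : ℕ} (M : CPS.Model n p m) (S : CPS.Channels n m p' m')
    (ctrl : CPS.DefenderStrategy p m) (att : CPS.FDIPolicy p' m') (T : ℕ)
    (hinv : ∀ k ≤ T, IsUnit (M.innovCov k)) :
    (∀ (ω : CPS.Noise n m), ∀ k ≤ T,
      M.residue S ctrl att ω k
        = M.residue S ctrl CPS.FDIPolicy.none ω k + M.residueBias S att k) ∧
    M.informationFlow S ctrl att T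
      = ENNReal.ofReal
          (1 / (2 * ((T : ℝ) + 1)) *
            ∑ k ∈ Finset.range (T + 1), M.residueBias S att k ⬝ᵥ M.residueBias S att k) := by
  refine ⟨fun ω k _ => ?_, ?_⟩
  · rw [M.residue_eq_noiseResidue_add, M.residue_eq_noiseResidue_add S ctrl CPS.FDIPolicy.none,
      M.residueBias_none, add_zero]
  · have hemb := (M.measurable_outputOfResidue ctrl T).measurableEmbedding
      (M.injective_outputOfResidue ctrl hinv)
    rw [CPS.Model.informationFlow, M.outputLaw_eq_map S ctrl att hinv,
      M.outputLaw_eq_map S ctrl CPS.FDIPolicy.none hinv,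
      CPS.klDiv_map_of_measurableEmbedding hemb]
    simp_rw [M.residueBias_none, Pi.zero_apply]
    have hT : (T : ℝ≥0∞) + 1 = ENNReal.ofReal ((T : ℝ) + 1) := by
      rw [ENNReal.ofReal_add (by positivity) zero_le_one]
      simp
    rw [CPS.klDiv_pi_gaussianReal, hT, ← ENNReal.ofReal_div_of_pos (by positivity),
      Fintype.sum_prod_type, Finset.sum_range]
    congr 1
    simp only [dotProduct, ← sq]
    field_simp
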